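/- A 2-tag system $T$ consists of a finite alphabet and a rule $\sigma\to u_\sigma$ (with $u_\sigma$ a word) for some of the symbols $\sigma$. A step deletes the two leftmost symbols $\sigma_1\sigma_2$ of the dataword and appends $u_{\sigma_1}$ at its right end. $T$ halts if the dataword has fewer than two symbols or $\sigma_1$ has no rule. A cyclic tag system $C$ is a nonempty list of binary words $\alpha_0,\dots,\alpha_{p-1}$ (appendants). A configuration is a marker $k\in\{0,\dots,p-1\}$ together with a binary dataword; on input $w$ the initial configuration has marker $0$ and dataword $w$. A step deletes the leftmost symbol of the dataword, appends $\alpha_k$ at its right end if the deleted symbol was $1$, and replaces $k$ by $(k+1)\bmod p$. $C$ halts when the dataword is empty. In both models a computation completes when it halts or enters a repeating sequence of configurations. Let the alphabet of a 2-tag system contain, for each marker value $k$, distinct symbols $\overline{x}_k,\dot{\overline{x}}_k,x_k,\dot{x}_k$ ($x\in\{0,1\}$) and $a_k,\dot a_k$. A configuration with marker $k$ and nonempty dataword $x_0x_1\cdots x_l$ is encoded as the word that consists of the barred pair $\overline{x_0}_k\dot{\overline{x_0}}_k$, followed by the unbarred pairs $(x_1)_k(\dot{x}_1)_k,\dots,(x_l)_k(\dot{x}_l)_k$,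 with a block of $v$ pairs $a_k\dot a_k$ (the counter) inserted directly after the pair for $x_i$, for some $0\le i\le l$, where $v$ is a power of two greater than $l$. An input $x_0\cdots x_l$ is encoded with $k=0$, $i=l$ and $v=2^{\lceil\log_2(l+1)\rceil}$. Theorem. For every cyclic tag system $C$ there is a 2-tag system $T_C$ (whose alphabet contains the encoding symbols) such that the following holds for all nonempty inputs $w$ at least as long as the longest appendant of $C$. Started on the encoding of $w$, $T_C$ passes successively, at steps $0=\tau_w(0)<\tau_w(1)<\cdots$, through encodings of the configurations of $C$ on input $w$ after $0,1,2,\dots$ steps, as long as the dataword of $C$ is nonempty, and $T_C$ halts if the dataword of $C$ becomes empty. Moreover, if the computation of $C$ completes within $t(n)$ steps on every nonempty input of every length $n$ that is at least the length of its longest appendant, then there is a function $s(n)=O(t(n)^2\log t(n))$ such that, on the encoding of every such input $w$ of length $n$, $T_C$ completes its computation within $s(n)$ steps, and $\tau_w(k)\le s(n)$ for all $k\le t(n)$ for which $C$ reaches a nonempty dataword after $k$ steps. -/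

import Mathlib

open Asymptotics Filter

/-! ### Deterministic computations -/

/-- The configuration reached after exactly `k` computation steps (`none` if there is no such
configuration, because some earlier configuration has no successor). -/
def run {α : Type} (step : α → Option α) : ℕ → α → Option α
  | 0, c => some c
  | k + 1, c => (run step k c).bind step

/-- The computation is complete in configuration `c`: either `c` has no successor, or `c` lies on
a repeating sequence of configurations. -/
def Completed {α : Type} (step : α → Option α) (c : α) : Prop :=
  step c = none ∨ ∃ m, 1 ≤ m ∧ run step m c = some c

/-- The computation from `c` completes after at most `k` steps. -/
def CompletesWithin {α : Type} (step : α → Option α) (c : α) (k : ℕ) : Prop :=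
  ∃ j, j ≤ k ∧ ∃ d, run step j c = some d ∧ Completed step d

/-! ### 2-tag systems -/

/-- A (deterministic) 2-tag system: a finite alphabet and a finite set of rules, at most one for
each symbol. -/
structure TwoTagSystem where
  Symbol : Type
  finite_symbol : Finite Symbol
  rule : Symbol → Option (List Symbol)

/-- Delete the two leftmost symbols and append the word given by the rule for the leftmost one.
There is no step if the dataword has fewer than two symbols or the leftmost symbol has no rule. -/
def TwoTagSystem.step (T : TwoTagSystem) : List T.Symbol → Option (List T.Symbol)
  | a :: _ :: w => (T.rule a).map fun u => w ++ u
  | _ => none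

/-! ### Cyclic tag systems -/

/-- A cyclic tag system: a nonempty list of `p` binary words, the appendants
(`true` is the symbol 1, `false` is the symbol 0). -/
structure CyclicTagSystem where
  p : ℕ
  p_pos : 0 < p
  appendant : Fin p → List Bool

namespace CyclicTagSystem

/-- A configuration: the marker, pointing to an appendant, and the dataword. -/
structure Config (C : CyclicTagSystem) where
  marker : Fin C.p
  data : List Bool

/-- The initial configuration on input `w`. -/
def init (C : CyclicTagSystem) (w : List Bool) : C.Config := ⟨⟨0, C.p_pos⟩, w⟩

/-- Delete the leftmost symbol, append the marked appendant if that symbol was 1, and move the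
marker cyclically. There is no step on the empty dataword. -/
def step (C : CyclicTagSystem) (c : C.Config) : Option C.Config :=
  match c.data with
  | [] => none
  | x :: xs => some
      ⟨⟨(c.marker.val + 1) % C.p, Nat.mod_lt _ C.p_pos⟩,
        if x then xs ++ C.appendant c.marker else xs⟩

/-- `w` is an admissible input: nonempty and at least as long as every appendant. -/
def IsInput (C : CyclicTagSystem) (w : List Bool) : Prop :=
  w ≠ [] ∧ ∀ k, (C.appendant k).length ≤ w.length

/-- `C` computes in time `t`, on the admissible inputs. -/
def ComputesInTime (C : CyclicTagSystem) (t : ℕ → ℕ) : Prop :=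
  ∀ w, C.IsInput w → CompletesWithin C.step (C.init w) (t w.length)

end CyclicTagSystem

/-! ### Encoding cyclic tag configurations as 2-tag datawords -/

/-- The symbols used for encoding. Each comes undotted (`dotted = false`) and dotted
(`dotted = true`), and is decorated with the value `k` of the marker: barred binary symbols,
unbarred binary symbols, and the counter symbol `a`. -/
inductive EncSymbol (p : ℕ) where
  | barred (k : Fin p) (x : Bool) (dotted : Bool)
  | unbarred (k : Fin p) (x : Bool) (dotted : Bool)
  | counter (k : Fin p) (dotted : Bool)

/-- The pair of barred symbols encoding the read symbol `x`. -/
def barredPair {p : ℕ} (k : Fin p) (x : Bool) : List (EncSymbol p) :=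
  [.barred k x false, .barred k x true]

/-- The pair of unbarred symbols encoding `x`. -/
def unbarredPair {p : ℕ} (k : Fin p) (x : Bool) : List (EncSymbol p) :=
  [.unbarred k x false, .unbarred k x true]

/-- A unary counter of value `v`: `v` pairs of counter symbols. -/
def counterWord {p : ℕ} (k : Fin p) (v : ℕ) : List (EncSymbol p) :=
  (List.replicate v [EncSymbol.counter k false, EncSymbol.counter k true]).flatten

/-- The encoding of a dataword `x₀ x₁ … x_l` with marker `k`, and a counter of value `v` placed
directly after the pair that encodes `x_i`. Only used for nonempty datawords. -/
def encode {p : ℕ} (k : Fin p) (w : List Bool) (i v : ℕ) : List (EncSymbol p) :=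
  match w with
  | [] => []
  | x :: xs =>
      barredPair k x ++ (xs.take i).flatMap (unbarredPair k) ++ counterWord k v ++
        (xs.drop i).flatMap (unbarredPair k)

namespace CyclicTagSystem

/-- The encoding of the input `w = x₀ … x_l`: the counter stands at the right end and has value
`2 ^ ⌈log₂ (l + 1)⌉`. -/
def encodeInput (C : CyclicTagSystem) (w : List Bool) : List (EncSymbol C.p) :=
  encode ⟨0, C.p_pos⟩ w (w.length - 1) (2 ^ Nat.clog 2 w.length)

/-- The word `v` encodes the configuration `c`, whose dataword `x₀ … x_l` is nonempty: the
counter stands after some `x_i`, `i ≤ l`, and its value is a power of two greater than `l`. -/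
def IsEncoding (C : CyclicTagSystem) (c : C.Config) (v : List (EncSymbol C.p)) : Prop :=
  c.data ≠ [] ∧ ∃ i m, i < c.data.length ∧ c.data.length ≤ 2 ^ m ∧
    v = encode c.marker c.data i (2 ^ m)

/-- `T` simulates the computation of `C` on input `w`, the encoding symbols being symbols of `T`
through `ι`. Started on the encoded input, `T` has after `τ k` steps a dataword that encodes the
configuration of `C` after `k` steps, as long as the dataword of `C` is nonempty. If the
dataword of `C` becomes empty, then `T` halts. -/
def Simulates (C : CyclicTagSystem) (T : TwoTagSystem) (ι : EncSymbol C.p ↪ T.Symbol)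
    (w : List Bool) (τ : ℕ → ℕ) : Prop :=
  τ 0 = 0 ∧ StrictMono τ ∧
  (∀ k c, run C.step k (C.init w) = some c → c.data ≠ [] →
    ∃ v, C.IsEncoding c v ∧
      run T.step (τ k) ((C.encodeInput w).map ι) = some (v.map ι)) ∧
  (∀ k c, run C.step k (C.init w) = some c → c.data = [] →
    ∃ m u, run T.step m ((C.encodeInput w).map ι) = some u ∧ T.step u = none)

end CyclicTagSystem

/-! ### Runs of deterministic computations -/

/-! The word of the 2-tag system is a sequence of tokens of two or three symbols. Symbols vanish in
pairs, so each token is entered in one of two phases, and this bit travels along the word: it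
selects between two productions of a token, and three-symbol tokens flip it. A pass over the word is
thus a run of a two-state transducer (`Scan`), and a head token closing the word records phases for
later passes.

The obstacle in simulating a step is to find the new leftmost datum, since all data tokens look
alike. Every datum starts as a candidate, and candidates flip the phase, so a round keeps every
second one beginning with the first: `N` candidates become `⌈N/2⌉`, and the leftmost survives alone.
The old counter, doubled to `2 ^ (m + 1) ≥ N` ticks, is halved in each round; the round that finds
the odd value 1 is the last, and there the survivor is barred. If there are no data, the head
reports an even number of candidates in the last round and meets a missing rule.

The new counter grows from `2 ^ R` growers, `R = maxAppendant`, which double in each round. A round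
with an even positive number of candidates occurs for the last time when that number is 2, which is
round `⌈log₂ N⌉`. Even rounds secure all growers, odd rounds secure no new ones, and only secured
growers survive. For `N ≥ 1` the new value is therefore `2 ^ R * 2 ^ ⌈log₂ N⌉`, however many rounds
were run (`reaches_rounds`). It stays proportional to the length of the dataword, and its factor `2
^ R` leaves room for the next appendant.

A step of `C` on a dataword of length at most `L`, with a counter of size `O(L)`, costs `O(log L)`
rounds of `O(L)` steps each. Here `L ≤ n + t * R`, which is `O(t)` because all-zero inputs force `n
≤ t n` for large `n`. -/

theorem run_add {α : Type} (step : α → Option α) (m n : ℕ) (c : α) :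
    run step (m + n) c = (run step m c).bind (run step n) := by
  induction n with
  | zero => cases h : run step m c <;> simp [run]
  | succ n ih => rw [← Nat.add_assoc, run, ih, Option.bind_assoc]; rfl

theorem run_one {α : Type} (step : α → Option α) (c : α) : run step 1 c = step c := rfl

theorem run_trans {α : Type} {step : α → Option α} {m n : ℕ} {x y z : α}
    (h₁ : run step m x = some y) (h₂ : run step n y = some z) : run step (m + n) x = some z := by
  rw [run_add, h₁, Option.bind_some, h₂]

/-- The configuration `y` is reached from `x` in at most `B` steps. -/
def Reaches {α : Type} (step : α → Option α) (B : ℕ) (x y : α) : Prop :=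
  ∃ n ≤ B, run step n x = some y

/-- The computation from `x` halts after at most `B` steps. -/
def HaltsWithin {α : Type} (step : α → Option α) (B : ℕ) (x : α) : Prop :=
  ∃ y, Reaches step B x y ∧ step y = none

theorem Reaches.refl {α : Type} (step : α → Option α) (x : α) : Reaches step 0 x x :=
  ⟨0, le_rfl, rfl⟩

theorem Reaches.trans {α : Type} {step : α → Option α} {A B : ℕ} {x y z : α}
    (h₁ : Reaches step A x y) (h₂ : Reaches step B y z) : Reaches step (A + B) x z := by
  obtain ⟨m, hm, h₁⟩ := h₁
  obtain ⟨n, hn, h₂⟩ := h₂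
  exact ⟨m + n, Nat.add_le_add hm hn, run_trans h₁ h₂⟩

theorem Reaches.mono {α : Type} {step : α → Option α} {A B : ℕ} {x y : α}
    (h : Reaches step A x y) (hAB : A ≤ B) : Reaches step B x y := by
  obtain ⟨m, hm, h⟩ := h
  exact ⟨m, hm.trans hAB, h⟩

theorem Reaches.haltsWithin {α : Type} {step : α → Option α} {A B : ℕ} {x y : α}
    (h₁ : Reaches step A x y) (h₂ : HaltsWithin step B y) : HaltsWithin step (A + B) x := by
  obtain ⟨z, h₂, hz⟩ := h₂
  exact ⟨z, h₁.trans h₂, hz⟩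

theorem HaltsWithin.mono {α : Type} {step : α → Option α} {A B : ℕ} {x : α}
    (h : HaltsWithin step A x) (hAB : A ≤ B) : HaltsWithin step B x := by
  obtain ⟨z, h, hz⟩ := h
  exact ⟨z, h.mono hAB, hz⟩

/-! ### Tokens

The dataword of the 2-tag system is a sequence of tokens, each of two or three symbols. A token is
entered at its first symbol (parity `false`) or its second symbol (parity `true`), and a token of
three symbols switches the parity. -/

/-- The four passes over the dataword that make up one round. -/
inductive Pass where
  | thin
  | double
  | halve
  | finish

/-- Besides the encoding tokens: data (with a flag for the candidates for the next read symbol),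
ticks (the old counter), growers (the new counter, with a flag for the part that is secured), and
the head, which ends the word and remembers two parities. -/
inductive Token (p : ℕ) where
  | barred (k : Fin p) (x : Bool)
  | unbarred (k : Fin p) (x : Bool)
  | counter (k : Fin p)
  | data (φ : Pass) (k : Fin p) (x c : Bool)
  | tick (φ : Pass)
  | grower (φ : Pass) (k : Fin p) (f : Bool)
  | head (φ : Pass) (q r : Bool)

instance : Finite Pass := by
  refine Finite.of_injective (β := Fin 4)
    (fun φ => match φ with | .thin => 0 | .double => 1 | .halve => 2 | .finish => 3) ?_
  rintro (_ | _) (_ | _) h <;> simp_all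

instance (p : ℕ) : Finite (Token p) := by
  refine Finite.of_injective
    (β := (Fin p × Bool) ⊕ (Fin p × Bool) ⊕ Fin p ⊕ (Pass × Fin p × Bool × Bool) ⊕ Pass ⊕
      (Pass × Fin p × Bool) ⊕ (Pass × Bool × Bool))
    (fun t => match t with
      | .barred k x => .inl (k, x)
      | .unbarred k x => .inr (.inl (k, x))
      | .counter k => .inr (.inr (.inl k))
      | .data φ k x c => .inr (.inr (.inr (.inl (φ, k, x, c))))
      | .tick φ => .inr (.inr (.inr (.inr (.inl φ))))
      | .grower φ k f => .inr (.inr (.inr (.inr (.inr (.inl (φ, k, f))))))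
      | .head φ q r => .inr (.inr (.inr (.inr (.inr (.inr (φ, q, r))))))) ?_
  rintro (_ | _) (_ | _) h <;> simp_all

/-- Whether the token consists of three symbols. -/
def Token.odd {p : ℕ} : Token p → Bool
  | .data .thin _ _ c => c
  | .tick .halve => true
  -- These two heads have a third symbol exactly when their pass is entered with parity `true`, so
  -- that the next pass starts with parity `false`.
  | .head .double q _ => q
  | .head .finish _ r => r
  | _ => false

/-- The word of symbols that make up a token. -/
def Token.spell {p : ℕ} (t : Token p) : List (Token p × Fin 3) :=
  if t.odd then [(t, 0), (t, 1), (t, 2)] else [(t, 0), (t, 1)]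

/-- The word of symbols that make up a sequence of tokens. -/
def spell {p : ℕ} (L : List (Token p)) : List (Token p × Fin 3) := L.flatMap Token.spell

/-- The dataword in which a sequence of tokens is about to be entered with parity `q`. -/
def spellFrom {p : ℕ} (q : Bool) (L : List (Token p)) : List (Token p × Fin 3) :=
  if q then (spell L).tail else spell L

theorem spell_append {p : ℕ} (L M : List (Token p)) : spell (L ++ M) = spell L ++ spell M := by
  simp [spell]

theorem spell_cons {p : ℕ} (t : Token p) (L : List (Token p)) :
    spell (t :: L) = t.spell ++ spell L := by
  simp [spell]

theorem spell_eq_cons {p : ℕ} {L : List (Token p)} (hL : L ≠ []) :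
    ∃ a b l, spell L = a :: b :: l := by
  obtain ⟨t, L, rfl⟩ := List.exists_cons_of_ne_nil hL
  cases h : t.odd <;> simp [spell_cons, Token.spell, h]

/-! ### Thinning out the candidates -/

/-- Keep every second candidate. -/
def alternate : Bool → List (Bool × Bool) → List (Bool × Bool)
  | _, [] => []
  | q, (x, c) :: D => (x, c && !q) :: alternate (xor q c) D

/-- The parity after a list of data whose candidates switch the parity. -/
def alternateParity : Bool → List (Bool × Bool) → Bool
  | q, [] => q
  | q, (_, c) :: D => alternateParity (xor q c) D

/-- The number of candidates. -/
def candidates (D : List (Bool × Bool)) : ℕ := D.countP (·.2)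

theorem candidates_cons (x c : Bool) (D : List (Bool × Bool)) :
    candidates ((x, c) :: D) = candidates D + c.toNat := by
  cases c <;> simp [candidates]

theorem alternate_append (q : Bool) (D E : List (Bool × Bool)) :
    alternate q (D ++ E) = alternate q D ++ alternate (alternateParity q D) E := by
  induction D generalizing q with
  | nil => rfl
  | cons d D ih => obtain ⟨x, c⟩ := d; simp [alternate, alternateParity, ih]

theorem alternateParity_append (q : Bool) (D E : List (Bool × Bool)) :
    alternateParity q (D ++ E) = alternateParity (alternateParity q D) E := by
  induction D generalizing q with
  | nil => rfl
  | cons d D ih => obtain ⟨x, c⟩ := d; simp [alternateParity, ih]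

theorem map_fst_alternate (q : Bool) (D : List (Bool × Bool)) :
    (alternate q D).map Prod.fst = D.map Prod.fst := by
  induction D generalizing q with
  | nil => rfl
  | cons d D ih => obtain ⟨x, c⟩ := d; simp [alternate, ih]

theorem length_alternate (q : Bool) (D : List (Bool × Bool)) :
    (alternate q D).length = D.length := by
  simpa using congrArg List.length (map_fst_alternate q D)

/-- From parity `false` the first, third, … candidates survive, from parity `true` the second,
fourth, …. -/
theorem candidates_alternate (q : Bool) (D : List (Bool × Bool)) :
    candidates (alternate q D) = (candidates D + (!q).toNat) / 2 := by
  induction D generalizing q with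
  | nil => cases q <;> rfl
  | cons d D ih =>
    obtain ⟨x, c⟩ := d
    rw [alternate, candidates_cons, candidates_cons, ih]
    cases q <;> cases c <;> (simp; try omega)

theorem alternateParity_eq (q : Bool) (D : List (Bool × Bool)) :
    alternateParity q D = xor q (decide (candidates D % 2 = 1)) := by
  induction D generalizing q with
  | nil => simp [alternateParity, candidates]
  | cons d D ih =>
    obtain ⟨x, c⟩ := d
    rw [alternateParity, candidates_cons, ih]
    rcases Nat.mod_two_eq_zero_or_one (candidates D) with h | h <;> cases q <;> cases c <;>
      simp [Nat.add_mod, h]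

/-! ### Doubling and securing the growers -/

/-- Double a list of growers; they are all secured unless the parity is `true`. -/
def growFlags (q : Bool) (F : List Bool) : List Bool :=
  F.flatMap fun f => [f || !q, !q]

theorem length_growFlags (q : Bool) (F : List Bool) :
    (growFlags q F).length = 2 * F.length := by
  induction F with
  | nil => rfl
  | cons f F ih =>
    simp only [growFlags, List.flatMap_cons, List.length_append, List.length_cons,
      List.length_nil] at ih ⊢
    omega

/-- With parity `true` each grower yields a copy of itself and an unsecured one; with parity `false`
both copies are secured. -/
theorem count_growFlags (q : Bool) (F : List Bool) :
    (growFlags q F).count true = if q then F.count true else 2 * F.length := by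
  induction F with
  | nil => cases q <;> rfl
  | cons f F ih =>
    simp only [growFlags, List.flatMap_cons, List.count_append] at ih ⊢
    rw [ih]
    cases q <;> cases f <;> simp <;> omega

/-! ### The rules of the simulating 2-tag system -/

namespace CyclicTagSystem

variable (C : CyclicTagSystem)

/-- The marker after the marker `k`. -/
def nextMarker (k : Fin C.p) : Fin C.p := ⟨(k.val + 1) % C.p, Nat.mod_lt _ C.p_pos⟩

/-- A bound for the lengths of the appendants. -/
def maxAppendant : ℕ := ∑ k, (C.appendant k).length

/-- What a token emits when it is entered with the given parity. -/
def emit : Token C.p → Bool → Option (List (Token C.p))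
  | .barred k x, _ => some ((if x then (C.appendant k).map (.unbarred k) else []) ++
      List.replicate (2 ^ C.maxAppendant) (.grower .finish k true) ++ [.head .finish true false])
  | .unbarred k x, _ => some [.data .thin k x true]
  | .counter _, _ => some [.tick .thin, .tick .thin]
  | .data .thin k x c, q => some [.data .double k x (c && !q)]
  | .data .double k x c, _ => some [.data .halve k x c]
  | .data .halve k x c, _ => some [.data .finish k x c]
  | .data .finish k x c, false => some [.data .thin k x c]
  | .data .finish k x true, true => some [.barred (C.nextMarker k) x]
  | .data .finish k x false, true => some [.unbarred (C.nextMarker k) x]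
  | .tick .thin, _ => some [.tick .double]
  | .tick .double, _ => some [.tick .halve]
  | .tick .halve, q => some (if q then [] else [.tick .finish])
  | .tick .finish, q => some (if q then [] else [.tick .thin])
  | .grower .thin k f, _ => some [.grower .double k f]
  | .grower .double k f, q => some [.grower .halve k (f || !q), .grower .halve k (!q)]
  | .grower .halve k f, _ => some [.grower .finish k f]
  | .grower .finish k f, false => some [.grower .thin k f]
  | .grower .finish k f, true => some (if f then [.counter (C.nextMarker k)] else [])
  | .head .thin _ _, q => some [.head .double q false]
  | .head .double q r, _ => some [.head .halve q r]
  | .head .halve q _, r => some [.head .finish q r]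
  | .head .finish _ _, false => some [.head .thin false false]
  | .head .finish true _, true => some []
  -- In the last round an even number of candidates means none: the dataword of `C` is empty.
  | .head .finish false _, true => none

/-- The 2-tag system that simulates `C`. -/
def toTwoTag : TwoTagSystem where
  Symbol := Token C.p × Fin 3
  finite_symbol := inferInstance
  rule a :=
    if a.2 = 0 then (C.emit a.1 false).map spell
    else if a.2 = 1 then (C.emit a.1 true).map spell
    else some []

/-- The step function of the simulating 2-tag system, on words of symbols. -/
def tagStep : List (Token C.p × Fin 3) → Option (List (Token C.p × Fin 3)) := C.toTwoTag.step

theorem tagStep_zero (t : Token C.p) (b : Token C.p × Fin 3) (w : List (Token C.p × Fin 3)) :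
    C.tagStep ((t, 0) :: b :: w) = (C.emit t false).map fun e => w ++ spell e := by
  simp [tagStep, TwoTagSystem.step, toTwoTag, Option.map_map, Function.comp_def]
  rfl

theorem tagStep_one (t : Token C.p) (b : Token C.p × Fin 3) (w : List (Token C.p × Fin 3)) :
    C.tagStep ((t, 1) :: b :: w) = (C.emit t true).map fun e => w ++ spell e := by
  simp [tagStep, TwoTagSystem.step, toTwoTag, Option.map_map, Function.comp_def]
  rfl

theorem tagStep_two (t : Token C.p) (b : Token C.p × Fin 3) (w : List (Token C.p × Fin 3)) :
    C.tagStep ((t, 2) :: b :: w) = some w := by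
  simp [tagStep, TwoTagSystem.step, toTwoTag]
  exact List.append_nil w

/-- The encoding symbols as symbols of the simulating 2-tag system. -/
def encEmbedding : EncSymbol C.p ↪ C.toTwoTag.Symbol where
  toFun
    | .barred k x d => (Token.barred k x, if d then 1 else 0)
    | .unbarred k x d => (Token.unbarred k x, if d then 1 else 0)
    | .counter k d => (Token.counter k, if d then 1 else 0)
  inj' := by
    rintro (⟨k, x, d⟩ | ⟨k, x, d⟩ | ⟨k, d⟩) (⟨k', x', d'⟩ | ⟨k', x', d'⟩ | ⟨k', d'⟩) h <;>
      have h := Prod.mk.inj h <;> cases d <;> cases d' <;> simp_all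

/-- A pair that starts at the last symbol of a token also consumes the first symbol of the next one,
hence `W ≠ []`. A third symbol that starts a pair emits nothing, which accounts for the possible
second step. -/
theorem token_reaches {t : Token C.p} {q : Bool} {e : List (Token C.p)} (h : C.emit t q = some e)
    {W : List (Token C.p)} (hW : W ≠ []) :
    Reaches C.tagStep 2 (spellFrom q (t :: W)) (spellFrom (xor q t.odd) (W ++ e)) := by
  obtain ⟨a, b, l, hl⟩ := spell_eq_cons hW
  cases q <;> cases ht : t.odd
  · exact ⟨1, by norm_num, by
      simp [run_one, spellFrom, spell_cons, spell_append, Token.spell, ht, tagStep_zero, h]⟩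
  · exact ⟨1 + 1, by norm_num, by
      simp [run, spellFrom, spell_cons, spell_append, Token.spell, ht, tagStep_zero,
        tagStep_two, h, hl]⟩
  · exact ⟨1, by norm_num, by
      simp [run_one, spellFrom, spell_cons, spell_append, Token.spell, ht, tagStep_one, h, hl]⟩
  · exact ⟨1, by norm_num, by
      simp [run_one, spellFrom, spell_cons, spell_append, Token.spell, ht, tagStep_one, h]⟩

/-! ### Passes as runs of a transducer -/

/-- Entered with parity `q`, the sequence `L` of tokens emits `o` and is left with parity `q'`. -/
inductive Scan : Bool → List (Token C.p) → List (Token C.p) → Bool → Prop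
  | nil (q : Bool) : Scan q [] [] q
  | cons {q q' : Bool} {t : Token C.p} {L e o : List (Token C.p)} (h : C.emit t q = some e)
      (hs : Scan (xor q t.odd) L o q') : Scan q (t :: L) (e ++ o) q'

variable {C}

theorem Scan.append {q q' q'' : Bool} {L M o o' : List (Token C.p)} (h : C.Scan q L o q')
    (h' : C.Scan q' M o' q'') : C.Scan q (L ++ M) (o ++ o') q'' := by
  induction h with
  | nil q => exact h'
  | cons h _ ih => rw [List.append_assoc]; exact .cons h (ih h')

theorem Scan.singleton {q : Bool} {t : Token C.p} {e : List (Token C.p)}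
    (h : C.emit t q = some e) : C.Scan q [t] e (xor q t.odd) := by
  simpa using Scan.cons h (Scan.nil _)

theorem Scan.reaches {q q' : Bool} {L o : List (Token C.p)} (h : C.Scan q L o q')
    {W : List (Token C.p)} (hW : W ≠ []) :
    Reaches C.tagStep (2 * L.length) (spellFrom q (L ++ W)) (spellFrom q' (W ++ o)) := by
  induction h generalizing W with
  | nil q => simpa using Reaches.refl _ _
  | @cons q q' t L e o h _ ih =>
    have h₁ := C.token_reaches h (W := L ++ W) (by simp [hW])
    have h₂ := ih (W := W ++ e) (by simp [hW])
    rw [List.append_assoc] at h₁ h₂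
    exact (h₁.trans h₂).mono (by simp; omega)

/-- The closing token `t` is entered when only the output `o` follows it, and may need the first
symbol of `o` to complete its last pair; hence `o ≠ []`. -/
theorem Scan.pass {q q' : Bool} {L o e : List (Token C.p)} {t : Token C.p}
    (h : C.Scan q L o q') (ho : o ≠ []) (ht : C.emit t q' = some e) :
    Reaches C.tagStep (2 * (L.length + 1)) (spellFrom q (L ++ [t]))
      (spellFrom (xor q' t.odd) (o ++ e)) :=
  ((h.reaches (W := [t]) (by simp)).trans ((Scan.singleton ht).reaches ho)).mono
    (by simp; omega)

theorem Scan.map {ι : Type} {q : Bool} {f : ι → Token C.p} {g : ι → List (Token C.p)}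
    (hf : ∀ d, (f d).odd = false) (hg : ∀ d, C.emit (f d) q = some (g d)) (D : List ι) :
    C.Scan q (D.map f) (D.flatMap g) q := by
  induction D with
  | nil => exact .nil q
  | cons d D ih => exact .cons (hg d) (by rw [hf, Bool.xor_false]; exact ih)

theorem Scan.replicate {q : Bool} {t : Token C.p} {e : List (Token C.p)}
    (ht : t.odd = false) (he : C.emit t q = some e) (a : ℕ) :
    C.Scan q (List.replicate a t) (List.replicate a e).flatten q := by
  induction a with
  | zero => exact .nil q
  | succ a ih => simpa [List.replicate_succ] using Scan.cons he (by simpa [ht] using ih)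

/-! ### One round -/

/-- The dataword of a pass, except for the head: data, the remaining old counter, the data from
the appendant, and the new counter. -/
def body (φ : Pass) (k : Fin C.p) (D : List (Bool × Bool)) (a : ℕ) (E : List (Bool × Bool))
    (F : List Bool) : List (Token C.p) :=
  D.map (fun d => .data φ k d.1 d.2) ++ (List.replicate a (.tick φ) ++
    (E.map (fun d => .data φ k d.1 d.2) ++ F.map (.grower φ k)))

theorem length_body (φ : Pass) (k : Fin C.p) (D : List (Bool × Bool)) (a : ℕ)
    (E : List (Bool × Bool)) (F : List Bool) :
    (body φ k D a E F).length = D.length + E.length + a + F.length := by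
  simp [body]; omega

theorem body_ne_nil (φ : Pass) (k : Fin C.p) (D : List (Bool × Bool)) (a : ℕ)
    (E : List (Bool × Bool)) {F : List Bool} (hF : F ≠ []) : body φ k D a E F ≠ [] := by
  simp [body, hF]

theorem Scan.thin (k : Fin C.p) (q : Bool) (D : List (Bool × Bool)) :
    C.Scan q (D.map fun d => .data .thin k d.1 d.2)
      ((alternate q D).map fun d => .data .double k d.1 d.2) (alternateParity q D) := by
  induction D generalizing q with
  | nil => exact .nil q
  | cons d D ih =>
    obtain ⟨x, c⟩ := d
    exact Scan.cons (e := [.data .double k x (c && !q)]) rfl (ih _)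

theorem Scan.halve (b : ℕ) :
    C.Scan false (List.replicate (2 * b) (.tick .halve)) (List.replicate b (.tick .finish))
      false := by
  induction b with
  | zero => exact .nil _
  | succ b ih =>
    exact Scan.cons (e := [.tick .finish]) rfl (Scan.cons (e := []) rfl ih)

/-- In this pass ticks have two symbols, so the parity reached after `D` carries over to `E` and the
two lists are thinned as one. The head stores the final parity, which is that of the number of
candidates. -/
theorem reaches_thin (k : Fin C.p) (D : List (Bool × Bool)) (a : ℕ) (E : List (Bool × Bool))
    {F : List Bool} (hF : F ≠ []) (q' r' : Bool) :
    Reaches C.tagStep (2 * (D.length + E.length + a + F.length + 1))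
      (spellFrom false (body .thin k D a E F ++ [.head .thin q' r']))
      (spellFrom (alternateParity false (D ++ E))
        (body .double k (alternate false D) a (alternate (alternateParity false D) E) F ++
          [.head .double (alternateParity false (D ++ E)) false])) := by
  have h : C.Scan false (body .thin k D a E F)
      (body .double k (alternate false D) a (alternate (alternateParity false D) E) F)
      (alternateParity false (D ++ E)) := by
    rw [alternateParity_append]
    refine (Scan.thin k false D).append (.append ?_ ((Scan.thin k _ E).append ?_))
    · simpa using Scan.replicate (t := .tick .thin) rfl rfl a
    · simpa [← List.map_eq_flatMap] using Scan.map (f := .grower .thin k)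
        (g := fun f => [.grower .double k f]) (fun _ => rfl) (fun _ => rfl) F
  simpa [length_body, Token.odd] using h.pass (body_ne_nil _ k _ a _ hF) (t := .head .thin q' r') rfl

theorem reaches_double (k : Fin C.p) (D : List (Bool × Bool)) (a : ℕ) (E : List (Bool × Bool))
    {F : List Bool} (hF : F ≠ []) (q : Bool) :
    Reaches C.tagStep (2 * (D.length + E.length + a + F.length + 1))
      (spellFrom q (body .double k D a E F ++ [.head .double q false]))
      (spellFrom false (body .halve k D a E (growFlags q F) ++ [.head .halve q false])) := by
  have hD (D : List (Bool × Bool)) : C.Scan q (D.map fun d => .data .double k d.1 d.2)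
      (D.map fun d => .data .halve k d.1 d.2) q := by
    simpa [← List.map_eq_flatMap] using Scan.map (f := fun d => .data .double k d.1 d.2)
      (g := fun d => [.data .halve k d.1 d.2]) (fun _ => rfl) (fun _ => rfl) D
  have h : C.Scan q (body .double k D a E F) (body .halve k D a E (growFlags q F)) q := by
    refine (hD D).append (.append ?_ ((hD E).append ?_))
    · simpa using Scan.replicate (t := .tick .double) rfl rfl a
    · simpa [growFlags, List.map_flatMap] using Scan.map (f := .grower .double k)
        (g := fun f => [.grower .halve k (f || !q), .grower .halve k (!q)])
        (fun _ => rfl) (fun _ => rfl) F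
  have hF' : growFlags q F ≠ [] := by
    rw [← List.length_pos_iff, length_growFlags]
    have := List.length_pos_iff.2 hF
    omega
  simpa [length_body, Token.odd] using h.pass (body_ne_nil _ k _ a _ hF')
    (t := .head .double q false) rfl

/-- The hypothesis `ha` covers both kinds of counter: an even one, with `r = false` (`Scan.halve`),
and the value 1, with `r = true`. -/
theorem reaches_halve (k : Fin C.p) (D : List (Bool × Bool)) {a b : ℕ} {r : Bool}
    (ha : C.Scan false (List.replicate a (.tick .halve)) (List.replicate b (.tick .finish)) r)
    (E : List (Bool × Bool)) {F : List Bool} (hF : F ≠ []) (q : Bool) :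
    Reaches C.tagStep (2 * (D.length + E.length + a + F.length + 1))
      (spellFrom false (body .halve k D a E F ++ [.head .halve q false]))
      (spellFrom r (body .finish k D b E F ++ [.head .finish q r])) := by
  have hD (q : Bool) (D : List (Bool × Bool)) :
      C.Scan q (D.map fun d => .data .halve k d.1 d.2)
        (D.map fun d => .data .finish k d.1 d.2) q := by
    simpa [← List.map_eq_flatMap] using Scan.map (f := fun d => .data .halve k d.1 d.2)
      (g := fun d => [.data .finish k d.1 d.2]) (fun _ => rfl) (fun _ => rfl) D
  have h : C.Scan false (body .halve k D a E F) (body .finish k D b E F) r := by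
    refine (hD _ D).append (ha.append ((hD _ E).append ?_))
    simpa [← List.map_eq_flatMap] using Scan.map (f := .grower .halve k)
      (g := fun f => [.grower .finish k f]) (fun _ => rfl) (fun _ => rfl) F
  simpa [length_body, Token.odd] using h.pass (body_ne_nil _ k _ b _ hF)
    (t := .head .halve q false) rfl

theorem reaches_continue (k : Fin C.p) (D : List (Bool × Bool)) (a : ℕ) (E : List (Bool × Bool))
    {F : List Bool} (hF : F ≠ []) (q : Bool) :
    Reaches C.tagStep (2 * (D.length + E.length + a + F.length + 1))
      (spellFrom false (body .finish k D a E F ++ [.head .finish q false]))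
      (spellFrom false (body .thin k D a E F ++ [.head .thin false false])) := by
  have hD (D : List (Bool × Bool)) : C.Scan false (D.map fun d => .data .finish k d.1 d.2)
      (D.map fun d => .data .thin k d.1 d.2) false := by
    simpa [← List.map_eq_flatMap] using Scan.map (f := fun d => .data .finish k d.1 d.2)
      (g := fun d => [.data .thin k d.1 d.2]) (fun _ => rfl) (fun _ => rfl) D
  have h : C.Scan false (body .finish k D a E F) (body .thin k D a E F) false := by
    refine (hD D).append (.append ?_ ((hD E).append ?_))
    · simpa using Scan.replicate (q := false) (t := .tick .finish) rfl rfl a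
    · simpa [← List.map_eq_flatMap] using Scan.map (f := .grower .finish k)
        (g := fun f => [.grower .thin k f]) (fun _ => rfl) (fun _ => rfl) F
  simpa [length_body, Token.odd] using h.pass (body_ne_nil _ k _ a _ hF)
    (t := .head .finish q false) (by cases q <;> rfl)

/-- The token that a datum becomes at the end of the simulation of a step. -/
def settle (k : Fin C.p) (d : Bool × Bool) : Token C.p :=
  if d.2 then .barred (C.nextMarker k) d.1 else .unbarred (C.nextMarker k) d.1

/-- With parity `true` the ticks vanish, which joins `D` and `E`, and the secured growers become the
new counter, at the right end. -/
theorem scan_settle (k : Fin C.p) (D : List (Bool × Bool)) (a : ℕ) (E : List (Bool × Bool))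
    (F : List Bool) :
    C.Scan true (body .finish k D a E F)
      ((D ++ E).map (settle k) ++ List.replicate (F.count true) (.counter (C.nextMarker k)))
      true := by
  have hD (D : List (Bool × Bool)) : C.Scan true (D.map fun d => .data .finish k d.1 d.2)
      (D.map (settle k)) true := by
    simpa [← List.map_eq_flatMap] using Scan.map (f := fun d => .data .finish k d.1 d.2)
      (g := fun d => [settle k d]) (fun _ => rfl)
      (by rintro ⟨x, c⟩; cases c <;> rfl) D
  have hF : C.Scan true (F.map (.grower .finish k))
      (List.replicate (F.count true) (.counter (C.nextMarker k))) true := by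
    induction F with
    | nil => exact .nil _
    | cons f F ih =>
      cases f
      · simpa using Scan.cons (q := true) (t := .grower .finish k false) rfl ih
      · simpa [List.replicate_succ] using Scan.cons (q := true) (t := .grower .finish k true) rfl ih
  rw [List.map_append, List.append_assoc]
  refine (hD D).append ?_
  simpa using (Scan.replicate (t := .tick .finish) rfl rfl a).append ((hD E).append hF)

theorem haltsWithin_finish (k : Fin C.p) (D : List (Bool × Bool)) (a : ℕ)
    (E : List (Bool × Bool)) (F : List Bool) :
    HaltsWithin C.tagStep (2 * (D.length + E.length + a + F.length + 1))
      (spellFrom true (body .finish k D a E F ++ [.head .finish false true])) := by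
  refine ⟨_, ((scan_settle k D a E F).reaches (by simp)).mono (by rw [length_body]; omega), ?_⟩
  cases h : spell (List.map (settle k) (D ++ E) ++
    List.replicate (F.count true) (.counter (C.nextMarker k))) <;>
    simp [spellFrom, spell_cons, Token.spell, Token.odd, tagStep_one, emit]

/-- The first three passes of a round. -/
theorem reaches_finish (k : Fin C.p) (D : List (Bool × Bool)) {a b : ℕ} {r : Bool}
    (ha : C.Scan false (List.replicate a (.tick .halve)) (List.replicate b (.tick .finish)) r)
    (E : List (Bool × Bool)) {F : List Bool} (hF : F ≠ []) :
    Reaches C.tagStep (6 * (D.length + E.length + a + 2 * F.length + 1))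
      (spellFrom false (body .thin k D a E F ++ [.head .thin false false]))
      (spellFrom r (body .finish k (alternate false D) b (alternate (alternateParity false D) E)
        (growFlags (alternateParity false (D ++ E)) F) ++
          [.head .finish (alternateParity false (D ++ E)) r])) := by
  have hF' (q : Bool) : growFlags q F ≠ [] := by
    rw [← List.length_pos_iff, length_growFlags]
    have := List.length_pos_iff.2 hF
    omega
  refine (((reaches_thin k D a E hF false false).trans (reaches_double k _ a _ hF _)).trans
    (reaches_halve k _ ha _ (hF' _) _)).mono ?_
  simp only [length_alternate, length_growFlags]
  omega

/-! ### Iterating the rounds -/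

/-- The rounds, until the old counter is used up. -/
theorem haltsWithin_rounds (k : Fin C.p) (m : ℕ) {F : List Bool} (hF : F ≠ []) :
    HaltsWithin C.tagStep ((m + 1) * (8 * (2 ^ m + F.length * 2 ^ (m + 1) + 1)))
      (spellFrom false (body .thin k [] (2 ^ m) [] F ++ [.head .thin false false])) := by
  induction m generalizing F with
  | zero =>
    have h₁ := reaches_finish k [] (a := 1) (b := 1) (r := true)
      (Scan.singleton (t := .tick .halve) rfl) [] hF
    refine (h₁.haltsWithin (haltsWithin_finish k _ 1 _ _)).mono ?_
    simp [length_growFlags, alternate]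
    omega
  | succ m ih =>
    have hF' : growFlags false F ≠ [] := by
      rw [← List.length_pos_iff, length_growFlags]
      have := List.length_pos_iff.2 hF
      omega
    have h₁ := reaches_finish k [] (Scan.halve (2 ^ m)) [] hF
    have h₂ := reaches_continue k [] (2 ^ m) [] hF' false
    rw [← pow_succ'] at h₁
    refine ((h₁.trans h₂).haltsWithin (ih hF')).mono ?_
    rw [length_growFlags]
    simp only [pow_succ, List.length_nil]
    generalize hA : 2 ^ m = A
    have hA' : 1 ≤ A := hA ▸ Nat.one_le_two_pow
    have : F.length ≤ F.length * A := Nat.le_mul_of_pos_right _ hA'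
    nlinarith [Nat.zero_le (m * A)]

/-- The invariant is that the leftmost datum is a candidate and that the ticks are at least as many
as the candidates. So when one tick is left, this datum is the only candidate. The bound allows `m +
1` rounds of four passes, with two steps per token. -/
theorem reaches_rounds (k : Fin C.p) (m : ℕ) {D E G : List (Bool × Bool)} {F : List Bool}
    (hF : F ≠ []) {x : Bool} (hDE : D ++ E = (x, true) :: G) (hm : candidates (D ++ E) ≤ 2 ^ m) :
    Reaches C.tagStep
      ((m + 1) * (8 * (D.length + E.length + 2 ^ m + F.length * 2 ^ (m + 1) + 1)))
      (spellFrom false (body .thin k D (2 ^ m) E F ++ [.head .thin false false]))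
      (spellFrom false (.barred (C.nextMarker k) x ::
        (G.map fun d => .unbarred (C.nextMarker k) d.1) ++
        List.replicate (if candidates (D ++ E) ≤ 1 then F.count true
          else F.length * 2 ^ Nat.clog 2 (candidates (D ++ E))) (.counter (C.nextMarker k)))) := by
  induction m generalizing D E G F with
  | zero =>
    have hthin := alternate_append false D E
    rw [hDE, alternate, Bool.not_false, Bool.and_true, Bool.false_xor] at hthin
    have hc : candidates (D ++ E) = 1 := by
      rw [hDE, candidates_cons] at hm ⊢
      simpa using hm
    have hq : alternateParity false (D ++ E) = true := by rw [alternateParity_eq, hc]; rfl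
    have hG : ∀ d ∈ alternate true G, d.2 = false := by
      have : candidates (alternate true G) = 0 := by
        rw [candidates_alternate]
        rw [hDE, candidates_cons] at hc
        simp at hc ⊢
        omega
      simpa [candidates, List.countP_eq_zero] using this
    have hmap : (alternate true G).map (settle k) =
        G.map fun d => .unbarred (C.nextMarker k) d.1 := by
      have h := congrArg (List.map (Token.unbarred (C.nextMarker k))) (map_fst_alternate true G)
      rw [List.map_map, List.map_map] at h
      refine Eq.trans (List.map_congr_left fun d hd => ?_) h
      simp [settle, hG d hd]
    have h₁ := reaches_finish k D (a := 1) (b := 1) (r := true)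
      (Scan.singleton (t := .tick .halve) rfl) E hF
    have h₂ := (scan_settle k (alternate false D) 1 (alternate (alternateParity false D) E)
      (growFlags true F)).pass (t := .head .finish true true) (e := []) (by simp [← hthin]) rfl
    rw [hq] at h₁
    have h₃ := h₁.trans h₂
    rw [← hthin, List.map_cons, hmap, count_growFlags, if_pos rfl, List.append_nil, length_body,
      length_alternate, length_alternate, length_growFlags] at h₃
    rw [if_pos hc.le]
    exact h₃.mono (by omega)
  | succ m ih =>
    have hthin := alternate_append false D E
    have hcand := candidates_alternate false (D ++ E)
    have hpar := alternateParity_eq false (D ++ E)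
    have hpos : 1 ≤ candidates (D ++ E) := by rw [hDE, candidates_cons]; simp
    have hF' : growFlags (alternateParity false (D ++ E)) F ≠ [] := by
      rw [← List.length_pos_iff, length_growFlags]
      have := List.length_pos_iff.2 hF
      omega
    have hG := congrArg (List.map (Token.unbarred (C.nextMarker k))) (map_fst_alternate true G)
    rw [List.map_map, List.map_map] at hG
    have h₁ := reaches_finish k D (Scan.halve (2 ^ m)) E hF
    rw [← pow_succ'] at h₁
    have h₂ := reaches_continue k (alternate false D) (2 ^ m)
      (alternate (alternateParity false D) E) hF' (alternateParity false (D ++ E))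
    rw [hthin] at hcand
    have h₃ := ih (G := alternate true G) hF' (hthin.symm.trans (by rw [hDE]; rfl))
      (by rw [hcand]; simp; omega)
    rw [show (alternate true G).map (fun d => Token.unbarred (C.nextMarker k) d.1) =
      G.map (fun d => Token.unbarred (C.nextMarker k) d.1) from hG, hcand, count_growFlags,
      length_growFlags] at h₃
    -- The counter formula is invariant under a round. One candidate: the secured growers are kept.
    -- Two: all `2 * F.length` growers are secured. At least three: halving with rounding up lowers
    -- the logarithm by one while the growers double.
    have hv : (if (candidates (D ++ E) + (!false).toNat) / 2 ≤ 1 then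
          if alternateParity false (D ++ E) = true then F.count true
          else 2 * F.length
        else 2 * F.length * 2 ^ Nat.clog 2 ((candidates (D ++ E) + (!false).toNat) / 2)) =
        if candidates (D ++ E) ≤ 1 then F.count true
          else F.length * 2 ^ Nat.clog 2 (candidates (D ++ E)) := by
      rw [hpar]
      generalize candidates (D ++ E) = c at hpos
      obtain rfl | rfl | hc : c = 1 ∨ c = 2 ∨ 3 ≤ c := by omega
      · simp
      · simp [mul_comm, show Nat.clog 2 2 = 1 by simpa using Nat.clog_pow 2 1 one_lt_two]
      · rw [if_neg (by simp; omega), if_neg (by omega),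
          Nat.clog_of_two_le (b := 2) (n := c) one_lt_two (by omega), pow_succ]
        simp only [Bool.not_false, Bool.toNat_true, Nat.add_succ_sub_one]
        ring
    rw [hv] at h₃
    refine ((h₁.trans h₂).trans h₃).mono ?_
    simp only [length_growFlags, length_alternate, pow_succ]
    generalize hA : 2 ^ m = A
    have hA' : 1 ≤ A := hA ▸ Nat.one_le_two_pow
    have : F.length ≤ F.length * A := Nat.le_mul_of_pos_right _ hA'
    nlinarith [Nat.zero_le (m * A)]

/-! ### Simulation of one step -/

/-- The dataword, as a sequence of tokens, for a nonempty configuration, with the counter at the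
right end. -/
def tokens (k : Fin C.p) (x : Bool) (xs : List Bool) (v : ℕ) : List (Token C.p) :=
  .barred k x :: xs.map (.unbarred k) ++ List.replicate v (.counter k)

theorem map_encode (k : Fin C.p) (x : Bool) (xs : List Bool) (v : ℕ) :
    (encode k (x :: xs) xs.length v).map C.encEmbedding = spell (tokens k x xs v) := by
  have h₁ : ∀ l : List Bool, (l.flatMap (unbarredPair k)).map C.encEmbedding =
      spell (l.map (.unbarred k)) := by
    intro l
    induction l with
    | nil => rfl
    | cons y l ih =>
      rw [List.flatMap_cons, List.map_append, ih]
      rfl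
  have h₂ : (counterWord k v).map C.encEmbedding = spell (List.replicate v (.counter k)) := by
    induction v with
    | zero => rfl
    | succ v ih =>
      rw [counterWord, List.replicate_succ, List.flatten_cons, List.map_append, ← counterWord, ih]
      rfl
  simp only [encode, List.take_length, List.drop_length, List.flatMap_nil, List.append_nil,
    List.map_append]
  rw [h₁ xs, h₂, tokens, spell_append, spell_cons]
  rfl

theorem candidates_candidate (l : List Bool) : candidates (l.map fun x => (x, true)) = l.length := by
  induction l with
  | nil => rfl
  | cons x l ih => rw [List.map_cons, candidates_cons, ih]; simp

/-- The data that a step appends. -/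
def appended (k : Fin C.p) (x : Bool) : List Bool := if x then C.appendant k else []

theorem length_appendant_le (k : Fin C.p) : (C.appendant k).length ≤ C.maxAppendant :=
  Finset.single_le_sum (f := fun k => (C.appendant k).length) (fun _ _ => Nat.zero_le _)
    (Finset.mem_univ k)

theorem length_appended_le (k : Fin C.p) (x : Bool) :
    (C.appended k x).length ≤ C.maxAppendant := by
  unfold appended
  split_ifs
  · exact length_appendant_le k
  · simp

/-- The beginning of the simulation of a step: one step of the 2-tag system that reads the barred
token, and one pass. -/
theorem exists_run_prepare (k : Fin C.p) (x : Bool) (xs : List Bool) {v : ℕ} (hv : 0 < v) :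
    ∃ y, C.tagStep (spell (tokens k x xs v)) = some y ∧
      Reaches C.tagStep (2 * (xs.length + v + C.maxAppendant + 2 ^ C.maxAppendant + 1)) y
        (spellFrom false (body .thin k (xs.map fun x => (x, true)) (2 * v)
          ((C.appended k x).map fun x => (x, true))
          (List.replicate (2 ^ C.maxAppendant) true) ++ [.head .thin false false])) := by
  set V := 2 ^ C.maxAppendant with hV
  refine ⟨spell ((xs.map (.unbarred k) ++ (List.replicate v (.counter k) ++
    ((C.appended k x).map (.unbarred k) ++ List.replicate V (.grower .finish k true)))) ++
    [.head .finish true false]), ?_, ?_⟩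
  · rw [tokens, List.cons_append, spell_cons]
    change C.tagStep ((_, 0) :: _ :: spell _) = _
    rw [tagStep_zero]
    cases x <;> simp [emit, appended, ← spell_append, hV]
  · have hD (l : List Bool) : C.Scan false (l.map (.unbarred k))
        ((l.map fun x => (x, true)).map fun d => .data .thin k d.1 d.2) false := by
      simpa [← List.map_eq_flatMap, Function.comp_def] using Scan.map (f := .unbarred k)
        (g := fun x => [.data .thin k x true]) (fun _ => rfl) (fun _ => rfl) l
    have hA : (List.replicate v [Token.tick (p := C.p) .thin, .tick .thin]).flatten =
        List.replicate (2 * v) (.tick .thin) := by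
      clear hv
      induction v with
      | zero => rfl
      | succ v ih => rw [List.replicate_succ, List.flatten_cons, ih]; rfl
    have hF : C.Scan false (List.replicate V (.grower .finish k true))
        ((List.replicate V true).map (.grower .thin k)) false := by
      simpa using Scan.replicate (q := false) (t := .grower .finish k true) rfl rfl V
    have hA' := Scan.replicate (C := C) (q := false) (t := .counter k) rfl rfl v
    rw [hA] at hA'
    have h := (hD xs).append (hA'.append ((hD (C.appended k x)).append hF))
    refine (h.pass (t := .head .finish true false) (by simp [hv.ne']) rfl).mono ?_
    have := C.length_appended_le k x
    simp
    omega

/-- A bound for the duration of the simulation of a step. -/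
def stepBound (C : CyclicTagSystem) (n m : ℕ) : ℕ :=
  -- The ticks number `2 ^ (m + 1)`, so there are `m + 2` rounds; one more summand pays for the
  -- preparation.
  (m + 3) * (8 * (n + 2 * 2 ^ C.maxAppendant + 2 ^ (m + 1) + 2 ^ C.maxAppendant * 2 ^ (m + 2) + 1))

theorem prepare_add_rounds_le {l r R V m : ℕ} (hr : r ≤ R) (hR : R ≤ V) :
    1 + 2 * (l + 2 ^ m + R + V + 1) +
      (m + 1 + 1) * (8 * (l + r + 2 ^ (m + 1) + V * 2 ^ (m + 1 + 1) + 1)) ≤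
    (m + 3) * (8 * (l + 2 * V + 2 ^ (m + 1) + V * 2 ^ (m + 2) + 1)) := by
  have h : (m + 1 + 1) * (8 * (l + r + 2 ^ (m + 1) + V * 2 ^ (m + 1 + 1) + 1)) ≤
      (m + 2) * (8 * (l + 2 * V + 2 ^ (m + 1) + V * 2 ^ (m + 2) + 1)) := by
    gcongr
    omega
  rw [show ∀ B, (m + 3) * B = B + (m + 2) * B from fun B => by ring]
  refine add_le_add ?_ h
  rw [pow_succ]
  have h₁ := Nat.zero_le (2 ^ m)
  have h₂ := Nat.zero_le (V * 2 ^ (m + 2))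
  linarith

/-- The simulation of a step that leaves a nonempty dataword. -/
theorem exists_run_step (k : Fin C.p) (x : Bool) (xs : List Bool) {m : ℕ}
    (hm : xs.length + 1 ≤ 2 ^ m) (hR : (C.appended k x).length ≤ 2 ^ m) {y : Bool} {ys : List Bool}
    (hy : xs ++ C.appended k x = y :: ys) :
    ∃ n, 1 ≤ n ∧ n ≤ C.stepBound xs.length m ∧
      run C.tagStep n (spell (tokens k x xs (2 ^ m))) =
        some (spell (tokens (C.nextMarker k) y ys
          (2 ^ (C.maxAppendant + Nat.clog 2 (ys.length + 1))))) := by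
  have hr := C.length_appended_le k x
  obtain ⟨z, hz, h₁⟩ := C.exists_run_prepare k x xs (v := 2 ^ m) (by positivity)
  have hDE : (xs.map fun x => (x, true)) ++ (C.appended k x).map (fun x => (x, true)) =
      (y, true) :: ys.map fun x => (x, true) := by
    rw [← List.map_append, hy, List.map_cons]
  have hc : candidates ((xs.map fun x => (x, true)) ++
      (C.appended k x).map (fun x => (x, true))) = ys.length + 1 := by
    rw [hDE, candidates_cons, candidates_candidate, Bool.toNat_true]
  have hlen := congrArg List.length hy
  rw [List.length_append, List.length_cons] at hlen
  -- Both `xs` and the appended word have length at most `2 ^ m`, so the doubled counter covers all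
  -- candidates.
  have h₂ := reaches_rounds k (m + 1) (F := List.replicate (2 ^ C.maxAppendant) true) (by simp) hDE
    (by rw [hc, pow_succ]; omega)
  rw [← pow_succ'] at h₁
  obtain ⟨n, hn, h⟩ := h₁.trans h₂
  refine ⟨1 + n, by omega, ?_, ?_⟩
  · rw [List.length_map, List.length_map, List.length_replicate] at hn
    have := prepare_add_rounds_le (l := xs.length) (m := m) hr Nat.lt_two_pow_self.le
    unfold stepBound
    omega
  · refine run_trans (y := z) hz (h.trans ?_)
    have hv : (if ys.length + 1 ≤ 1 then (List.replicate (2 ^ C.maxAppendant) true).count true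
        else (List.replicate (2 ^ C.maxAppendant) true).length * 2 ^ Nat.clog 2 (ys.length + 1)) =
        2 ^ (C.maxAppendant + Nat.clog 2 (ys.length + 1)) := by
      rw [pow_add]
      split_ifs with h
      · obtain h : ys.length = 0 := by omega
        simp [h]
      · simp
    rw [hc, hv, List.map_map]
    rfl

/-- The simulation of a step that leaves the empty dataword. -/
theorem haltsWithin_step (k : Fin C.p) (x : Bool) (xs : List Bool) (m : ℕ)
    (hx : xs ++ C.appended k x = []) :
    HaltsWithin C.tagStep (C.stepBound xs.length m) (spell (tokens k x xs (2 ^ m))) := by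
  have hr := C.length_appended_le k x
  obtain ⟨z, hz, h₁⟩ := C.exists_run_prepare k x xs (v := 2 ^ m) (by positivity)
  obtain ⟨rfl, hx⟩ := List.append_eq_nil_iff.1 hx
  rw [List.nil_append] at hx
  rw [hx, ← pow_succ'] at h₁
  have h₂ := haltsWithin_rounds k (m + 1) (F := List.replicate (2 ^ C.maxAppendant) true) (by simp)
  have h₃ : Reaches C.tagStep 1 (spell (tokens k x [] (2 ^ m))) z := ⟨1, le_rfl, hz⟩
  refine ((h₃.trans h₁).haltsWithin h₂).mono ?_
  have := prepare_add_rounds_le (l := 0) (m := m) (Nat.zero_le _)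
    (Nat.lt_two_pow_self (n := C.maxAppendant)).le
  rw [List.length_replicate]
  unfold stepBound
  simpa using this

/-! ### Simulation of a computation -/

theorem step_cons (k : Fin C.p) (x : Bool) (xs : List Bool) :
    C.step ⟨k, x :: xs⟩ = some ⟨C.nextMarker k, xs ++ C.appended k x⟩ := by
  cases x <;> simp [step, nextMarker, appended]

theorem length_data_le {w : List Bool} {k : ℕ} {c : C.Config}
    (h : run C.step k (C.init w) = some c) : c.data.length ≤ w.length + k * C.maxAppendant := by
  induction k generalizing c with
  | zero => obtain rfl := Option.some.inj h; simp [init]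
  | succ k ih =>
    obtain ⟨⟨i, d⟩, hd, hc⟩ := Option.bind_eq_some_iff.1 h
    have := ih hd
    cases d with
    | nil => simp [step] at hc
    | cons x xs =>
      rw [step_cons] at hc
      obtain rfl := Option.some.inj hc
      have := C.length_appended_le i x
      simp only [List.length_cons, List.length_append, add_one_mul] at *
      omega

/-- The exponent of the counter value after `k` steps. -/
def exponent (k : ℕ) (c : C.Config) : ℕ :=
  -- The counter of the input lacks the factor contributed by the initial growers, which all later
  -- counters have.
  (if k = 0 then 0 else C.maxAppendant) + Nat.clog 2 c.data.length

/-- The dataword of the 2-tag system after the simulation of `k` steps. -/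
def codeword (k : ℕ) (c : C.Config) : List (Token C.p × Fin 3) :=
  match c.data with
  | [] => []
  | x :: xs => spell (tokens c.marker x xs (2 ^ exponent k c))

theorem length_le_two_pow_exponent (k : ℕ) (c : C.Config) :
    c.data.length ≤ 2 ^ exponent k c :=
  (Nat.le_pow_clog one_lt_two _).trans (Nat.pow_le_pow_right two_pos (Nat.le_add_left _ _))

theorem codeword_eq_map_encode (k : ℕ) {c : C.Config} (hc : c.data ≠ []) :
    codeword k c = (encode c.marker c.data (c.data.length - 1) (2 ^ exponent k c)).map
      C.encEmbedding := by
  obtain ⟨i, d⟩ := c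
  obtain ⟨x, xs, rfl⟩ := List.exists_cons_of_ne_nil hc
  exact (map_encode i x xs _).symm

theorem codeword_init {w : List Bool} (hw : w ≠ []) :
    codeword 0 (C.init w) = (C.encodeInput w).map C.encEmbedding := by
  refine (codeword_eq_map_encode (c := C.init w) 0 hw).trans ?_
  simp [encodeInput, init, exponent]
  rfl

theorem isEncoding_codeword (k : ℕ) {c : C.Config} (hc : c.data ≠ []) :
    C.IsEncoding c (encode c.marker c.data (c.data.length - 1) (2 ^ exponent k c)) :=
  ⟨hc, _, _, Nat.sub_one_lt (by simpa using hc), length_le_two_pow_exponent k c, rfl⟩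

/-- A bound for the duration of the simulation of each of the first `k` steps on an input of
length `n`. -/
def runStepBound (C : CyclicTagSystem) (n k : ℕ) : ℕ :=
  C.stepBound (n + k * C.maxAppendant) (C.maxAppendant + Nat.clog 2 (n + k * C.maxAppendant))

theorem stepBound_mono {n n' m m' : ℕ} (hn : n ≤ n') (hm : m ≤ m') :
    C.stepBound n m ≤ C.stepBound n' m' := by
  unfold stepBound
  gcongr <;> norm_num

theorem runStepBound_mono {n k k' : ℕ} (hk : k ≤ k') :
    C.runStepBound n k ≤ C.runStepBound n k' := by
  unfold runStepBound
  have : n + k * C.maxAppendant ≤ n + k' * C.maxAppendant := by gcongr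
  exact stepBound_mono this (by gcongr)

theorem stepBound_le_runStepBound {w : List Bool} {k : ℕ} {i : Fin C.p} {x : Bool}
    {xs : List Bool} (h : run C.step k (C.init w) = some ⟨i, x :: xs⟩) :
    C.stepBound xs.length (exponent k ⟨i, x :: xs⟩) ≤ C.runStepBound w.length k := by
  have hl := length_data_le h
  simp only [List.length_cons] at hl
  refine stepBound_mono (by omega) (add_le_add ?_ (Nat.clog_mono_right 2 hl))
  split_ifs <;> simp

/-- At the start this is the admissibility of the input; later the counter has the factor `2 ^
maxAppendant`. -/
theorem length_appended_le_two_pow {w : List Bool} (hw : C.IsInput w) {k : ℕ} {i : Fin C.p}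
    {x : Bool} {xs : List Bool} (h : run C.step k (C.init w) = some ⟨i, x :: xs⟩) :
    (C.appended i x).length ≤ 2 ^ exponent k ⟨i, x :: xs⟩ := by
  cases k with
  | zero =>
    have h : x :: xs = w := congrArg Config.data (Option.some.inj h).symm
    refine le_trans ?_ (length_le_two_pow_exponent _ _)
    unfold appended
    split_ifs
    · exact (hw.2 i).trans_eq (by rw [h])
    · simp
  | succ k =>
    refine (C.length_appended_le i x).trans (Nat.lt_two_pow_self.le.trans ?_)
    exact Nat.pow_le_pow_right two_pos (by simp [exponent])

theorem exists_times {w : List Bool} (hw : C.IsInput w) :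
    ∃ τ : ℕ → ℕ, τ 0 = 0 ∧ StrictMono τ ∧ (∀ k, τ k ≤ k * C.runStepBound w.length k) ∧
      ∀ k c, run C.step k (C.init w) = some c → c.data ≠ [] →
        run C.tagStep (τ k) (codeword 0 (C.init w)) = some (codeword k c) := by
  have H (k : ℕ) : ∃ n, 1 ≤ n ∧ n ≤ C.runStepBound w.length k ∧
      ∀ c c', run C.step k (C.init w) = some c → C.step c = some c' → c'.data ≠ [] →
        run C.tagStep n (codeword k c) = some (codeword (k + 1) c') := by
    by_cases h : ∃ c c', run C.step k (C.init w) = some c ∧ C.step c = some c' ∧ c'.data ≠ []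
    · obtain ⟨⟨i, d⟩, c', hc, hc', hne⟩ := h
      cases d with
      | nil => simp [step] at hc'
      | cons x xs =>
        have hs := hc'
        rw [step_cons] at hs
        obtain rfl := Option.some.inj hs
        obtain ⟨y, ys, hy⟩ := List.exists_cons_of_ne_nil hne
        obtain ⟨n, h₁, h₂, h₃⟩ := exists_run_step i x xs
          (length_le_two_pow_exponent k ⟨i, x :: xs⟩) (length_appended_le_two_pow hw hc) hy
        refine ⟨n, h₁, h₂.trans (stepBound_le_runStepBound hc), fun c c'' h h' _ => ?_⟩
        obtain rfl := Option.some.inj (hc.symm.trans h)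
        obtain rfl := Option.some.inj (hc'.symm.trans h')
        simp only at hy
        simp only [codeword, hy, exponent, List.length_cons, Nat.add_eq_zero_iff, one_ne_zero,
          and_false, if_false]
        exact h₃
    -- If there is no successor with nonempty data, the value 1 only serves to keep `τ` strictly
    -- increasing.
    · refine ⟨1, le_rfl, ?_, fun c c' h₁ h₂ h₃ => (h ⟨c, c', h₁, h₂, h₃⟩).elim⟩
      unfold runStepBound stepBound
      exact Nat.mul_pos (Nat.succ_pos _) (Nat.mul_pos (by norm_num) (Nat.succ_pos _))
  choose δ h₁ h₂ h₃ using H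
  refine ⟨fun k => ∑ i ∈ Finset.range k, δ i, rfl, ?_, fun k => ?_, fun k => ?_⟩
  · exact strictMono_nat_of_lt_succ fun k => by rw [Finset.sum_range_succ]; have := h₁ k; omega
  · simpa using Finset.sum_le_card_nsmul (Finset.range k) δ _ fun i hi =>
      (h₂ i).trans (runStepBound_mono (Finset.mem_range.1 hi).le)
  · induction k with
    | zero =>
      intro c hc _
      obtain rfl := Option.some.inj hc
      rfl
    | succ k ih =>
      intro c' hc' hne
      obtain ⟨c, hc, hs⟩ := Option.bind_eq_some_iff.1 hc'
      change run C.tagStep (∑ i ∈ Finset.range (k + 1), δ i) _ = _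
      rw [Finset.sum_range_succ]
      exact run_trans (ih c hc fun h => by simp [step, h] at hs) (h₃ k c c' hc hs hne)

theorem haltsWithin_of_data_eq_nil {w : List Bool} (hw : C.IsInput w) {k : ℕ} {c : C.Config}
    (hc : run C.step k (C.init w) = some c) (h : c.data = []) :
    HaltsWithin C.tagStep (k * C.runStepBound w.length k) (codeword 0 (C.init w)) := by
  obtain ⟨τ, -, -, hτ, hrun⟩ := exists_times hw
  cases k with
  | zero => exact (hw.1 ((congrArg Config.data (Option.some.inj hc)).trans h)).elim
  | succ k =>
    obtain ⟨⟨i, d⟩, hd, hs⟩ := Option.bind_eq_some_iff.1 hc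
    cases d with
    | nil => simp [step] at hs
    | cons x xs =>
      rw [step_cons] at hs
      obtain rfl := Option.some.inj hs
      have h₁ : Reaches C.tagStep _ _ _ := ⟨τ k, hτ k, hrun k _ hd (by simp)⟩
      refine (h₁.haltsWithin (haltsWithin_step i x xs _ h)).mono ?_
      rw [add_one_mul]
      have := runStepBound_mono (C := C) (n := w.length) k.le_succ
      exact add_le_add (Nat.mul_le_mul_left k this)
        ((stepBound_le_runStepBound hd).trans this)

theorem data_ne_nil_of_run {c d : C.Config} {m : ℕ} (hm : 1 ≤ m) (h : run C.step m c = some d) :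
    c.data ≠ [] := by
  intro hc
  obtain ⟨m, rfl⟩ := Nat.exists_eq_add_of_le hm
  rw [run_add, run_one] at h
  simp [step, hc] at h

/-- From step 1 on the codeword depends only on the configuration, so a cycle of `C` yields a cycle
of the 2-tag system. At step 0 the counter may differ, so the cycle is entered one step later, hence
`t + 1`. -/
theorem completesWithin_tagStep {w : List Bool} (hw : C.IsInput w) {t : ℕ}
    (h : CompletesWithin C.step (C.init w) t) :
    CompletesWithin C.tagStep (codeword 0 (C.init w))
      ((t + 1) * C.runStepBound w.length (t + 1)) := by
  have hmono {j : ℕ} (hj : j ≤ t + 1) :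
      j * C.runStepBound w.length j ≤ (t + 1) * C.runStepBound w.length (t + 1) :=
    Nat.mul_le_mul hj (runStepBound_mono hj)
  obtain ⟨j, hj, d, hd, hn | ⟨m, hm, hr⟩⟩ := h
  · have hd' : d.data = [] := by
      obtain ⟨i, _ | ⟨x, xs⟩⟩ := d
      · rfl
      · simp [step_cons] at hn
    obtain ⟨y, ⟨n, hn, hy⟩, hnone⟩ := haltsWithin_of_data_eq_nil hw hd hd'
    exact ⟨n, hn.trans (hmono (by omega)), y, hy, .inl hnone⟩
  · obtain ⟨τ, -, hmonoτ, hτ, hrun⟩ := exists_times hw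
    obtain ⟨d', hd'⟩ : ∃ d', C.step d = some d' := by
      obtain ⟨i, d⟩ := d
      obtain ⟨x, xs, rfl⟩ := List.exists_cons_of_ne_nil (data_ne_nil_of_run hm hr)
      exact ⟨_, step_cons _ _ _⟩
    have h₁ : run C.step (j + 1) (C.init w) = some d' := run_trans (n := 1) hd hd'
    have hr' : run C.step m d' = some d' := by
      have h := run_trans (n := 1) hr hd'
      rw [add_comm, run_add, run_one, hd'] at h
      exact h
    have h₂ : run C.step (j + 1 + m) (C.init w) = some d' := run_trans h₁ hr'
    have hne := data_ne_nil_of_run hm hr'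
    have e₁ := hrun _ _ h₁ hne
    have e₂ := hrun _ _ h₂ hne
    have hlt : τ (j + 1) < τ (j + 1 + m) := hmonoτ (by omega)
    obtain ⟨n, hn⟩ := Nat.exists_eq_add_of_lt hlt
    refine ⟨τ (j + 1), (hτ _).trans (hmono (by omega)), _, e₁, .inr ⟨n + 1, by omega, ?_⟩⟩
    rw [hn, add_assoc, run_add, e₁] at e₂
    have : codeword (j + 1 + m) d' = codeword (j + 1) d' := by
      simp [codeword, exponent]
    rw [← this]
    rw [← this] at e₂
    exact e₂

/-! ### The time bound -/

theorem two_pow_clog_le {n : ℕ} (hn : 2 ≤ n) : 2 ^ Nat.clog 2 n ≤ 2 * n := by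
  have h := Nat.pow_pred_clog_lt_self one_lt_two (x := n) hn
  have h' : 1 ≤ Nat.clog 2 n := Nat.clog_pos one_lt_two hn
  rw [← Nat.succ_pred_eq_of_pos h', pow_succ]
  omega

theorem exists_runStepBound_le (C : CyclicTagSystem) :
    ∃ K, ∀ n t, n ≤ t → 2 ≤ t → C.runStepBound n (t + 1) ≤ K * (t * Nat.clog 2 t) := by
  set R := C.maxAppendant with hR
  set a := 1 + 2 * R with ha
  -- The factor `a` bounds the dataword by `a * t`, from `n ≤ t` and `t + 1 ≤ 2 * t`; the factor `b`
  -- bounds the counter, its final 2 coming from `2 ^ clog t ≤ 2 * t`.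
  set b := 2 ^ R * (2 ^ Nat.clog 2 a * 2) with hb
  refine ⟨(R + 3 + Nat.clog 2 a + 1) * (8 * (a + 2 * 2 ^ R + 2 * b + 2 ^ R * (4 * b) + 1)),
    fun n t hn ht => ?_⟩
  have hN : n + (t + 1) * R ≤ a * t := by nlinarith
  have hclog : Nat.clog 2 (n + (t + 1) * R) ≤ Nat.clog 2 a + Nat.clog 2 t := by
    refine Nat.clog_le_of_le_pow (hN.trans ?_)
    rw [pow_add]
    exact Nat.mul_le_mul (Nat.le_pow_clog one_lt_two _) (Nat.le_pow_clog one_lt_two _)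
  have hpos : 1 ≤ Nat.clog 2 t := Nat.clog_pos one_lt_two ht
  have hm : 2 ^ (R + Nat.clog 2 (n + (t + 1) * R)) ≤ b * t := by
    calc 2 ^ (R + Nat.clog 2 (n + (t + 1) * R))
        ≤ 2 ^ (R + (Nat.clog 2 a + Nat.clog 2 t)) :=
          Nat.pow_le_pow_right two_pos (by omega)
      _ = 2 ^ R * (2 ^ Nat.clog 2 a * 2 ^ Nat.clog 2 t) := by rw [pow_add, pow_add]
      _ ≤ 2 ^ R * (2 ^ Nat.clog 2 a * (2 * t)) := by gcongr; exact two_pow_clog_le ht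
      _ = b * t := by rw [hb]; ring
  have hm' : R + Nat.clog 2 (n + (t + 1) * R) + 3 ≤
      (R + 3 + Nat.clog 2 a + 1) * Nat.clog 2 t := by
    nlinarith
  unfold runStepBound stepBound
  rw [← hR]
  generalize R + Nat.clog 2 (n + (t + 1) * R) = m at hm hm'
  calc (m + 3) * (8 * (n + (t + 1) * R + 2 * 2 ^ R + 2 ^ (m + 1) + 2 ^ R * 2 ^ (m + 2) + 1))
      = (m + 3) * (8 * (n + (t + 1) * R + 2 * 2 ^ R + 2 * 2 ^ m + 2 ^ R * (4 * 2 ^ m) + 1)) := by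
        ring
    _ ≤ (R + 3 + Nat.clog 2 a + 1) * Nat.clog 2 t *
        (8 * (a * t + 2 * 2 ^ R * t + 2 * (b * t) + 2 ^ R * (4 * (b * t)) + 1 * t)) := by
        have h₁ : 2 * 2 ^ R ≤ 2 * 2 ^ R * t := Nat.le_mul_of_pos_right _ (by omega)
        have h₂ : 2 ^ R * (4 * 2 ^ m) ≤ 2 ^ R * (4 * (b * t)) := by gcongr
        exact Nat.mul_le_mul hm' (Nat.mul_le_mul_left 8 (by omega))
    _ = _ := by ring

/-! ### The running time is eventually at least the input length -/

/-- Symbols 0 are deleted one by one. -/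
theorem length_of_run_false {m : ℕ} {c d : C.Config} (hc : ∀ x ∈ c.data, x = false)
    (h : run C.step m c = some d) :
    d.data.length + m = c.data.length ∧ ∀ x ∈ d.data, x = false := by
  induction m generalizing d with
  | zero => obtain rfl := Option.some.inj h; exact ⟨rfl, hc⟩
  | succ m ih =>
    obtain ⟨⟨i, e⟩, he, hs⟩ := Option.bind_eq_some_iff.1 h
    obtain ⟨hl, hf⟩ := ih he
    cases e with
    | nil => simp [step] at hs
    | cons x xs =>
      rw [step_cons] at hs
      obtain rfl := Option.some.inj hs
      obtain rfl : x = false := hf x (by simp)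
      simp only [List.length_cons, List.mem_cons, forall_eq_or_imp, appended, Bool.false_eq_true,
        if_false, List.append_nil] at hl hf ⊢
      exact ⟨by omega, hf.2⟩

/-- On an all-zero input the dataword shrinks by one symbol per step, so no configuration repeats
and completion means deleting all `n` symbols. Admissibility needs `n` large. -/
theorem eventually_le_of_computesInTime {t : ℕ → ℕ} (ht : C.ComputesInTime t) :
    ∀ᶠ n in atTop, n ≤ t n := by
  filter_upwards [eventually_ge_atTop (C.maxAppendant + 1)] with n hn
  have hw : C.IsInput (List.replicate n false) := by
    refine ⟨by simp; omega, fun k => ?_⟩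
    have := C.length_appendant_le k
    rw [List.length_replicate]
    omega
  obtain ⟨j, hj, d, hd, h⟩ := ht _ hw
  obtain ⟨hl, hf⟩ := length_of_run_false (by simp [init]) hd
  simp only [init, List.length_replicate] at hl hj
  obtain h | ⟨m, hm, h⟩ := h
  · obtain ⟨i, _ | ⟨x, xs⟩⟩ := d
    · simp at hl
      omega
    · simp [step_cons] at h
  · have := (length_of_run_false hf h).1
    omega

end CyclicTagSystem

theorem theorem2 (C : CyclicTagSystem) :
    ∃ (T : TwoTagSystem) (ι : EncSymbol C.p ↪ T.Symbol) (τ : List Bool → ℕ → ℕ),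
      (∀ w, C.IsInput w → C.Simulates T ι w (τ w)) ∧
      ∀ t : ℕ → ℕ, C.ComputesInTime t →
        ∃ s : ℕ → ℕ,
          (∀ w, C.IsInput w →
            CompletesWithin T.step ((C.encodeInput w).map ι) (s w.length) ∧
            ∀ k ≤ t w.length, ∀ c, run C.step k (C.init w) = some c → c.data ≠ [] →
              τ w k ≤ s w.length) ∧
          (fun n => (s n : ℝ)) =O[atTop]
            (fun n => (t n : ℝ) ^ 2 * Real.logb 2 (t n : ℝ)) := by
  have H (w : List Bool) : ∃ τ : ℕ → ℕ, C.IsInput w → τ 0 = 0 ∧ StrictMono τ ∧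
      (∀ k, τ k ≤ k * C.runStepBound w.length k) ∧
      ∀ k c, run C.step k (C.init w) = some c → c.data ≠ [] →
        run C.tagStep (τ k) (CyclicTagSystem.codeword 0 (C.init w)) =
          some (CyclicTagSystem.codeword k c) := by
    by_cases hw : C.IsInput w
    · obtain ⟨τ, h⟩ := CyclicTagSystem.exists_times hw
      exact ⟨τ, fun _ => h⟩
    · exact ⟨id, fun h => (hw h).elim⟩
  choose τ hτ using H
  refine ⟨C.toTwoTag, C.encEmbedding, τ, fun w hw => ?_, fun t ht =>
    ⟨fun n => (t n + 1) * C.runStepBound n (t n + 1), fun w hw => ⟨?_, fun k hk c hc hne => ?_⟩,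
      ?_⟩⟩
  · obtain ⟨h₀, hmono, -, hrun⟩ := hτ w hw
    refine ⟨h₀, hmono, fun k c hc hne => ⟨_, CyclicTagSystem.isEncoding_codeword k hne, ?_⟩,
      fun k c hc hnil => ?_⟩
    · have h := hrun k c hc hne
      rw [CyclicTagSystem.codeword_init hw.1, CyclicTagSystem.codeword_eq_map_encode k hne] at h
      exact h
    · obtain ⟨u, ⟨m, -, h⟩, hu⟩ := CyclicTagSystem.haltsWithin_of_data_eq_nil hw hc hnil
      rw [CyclicTagSystem.codeword_init hw.1] at h
      exact ⟨m, u, h, hu⟩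
  · have h := CyclicTagSystem.completesWithin_tagStep hw (ht w hw)
    rw [CyclicTagSystem.codeword_init hw.1] at h
    exact h
  · exact ((hτ w hw).2.2.1 k).trans (Nat.mul_le_mul (by omega)
      (CyclicTagSystem.runStepBound_mono (by omega)))
  · obtain ⟨K, hK⟩ := C.exists_runStepBound_le
    -- One factor 2 comes from `t n + 1 ≤ 2 * t n`, the other from `⌈log₂ t⌉ ≤ 2 * log₂ t` for `t ≥
    -- 2`.
    refine IsBigO.of_bound (4 * K) ?_
    filter_upwards [CyclicTagSystem.eventually_le_of_computesInTime ht, eventually_ge_atTop 2]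
      with n hn h2
    have ht2 : 2 ≤ t n := h2.trans hn
    have hlog : 1 ≤ Real.logb 2 (t n) := by
      rw [Real.le_logb_iff_rpow_le one_lt_two (by positivity)]
      simpa using (by exact_mod_cast ht2 : (2 : ℝ) ≤ t n)
    have hclog : (Nat.clog 2 (t n) : ℝ) ≤ 2 * Real.logb 2 (t n) := by
      rw [← Real.natCeil_logb_natCast]
      have := Nat.ceil_lt_add_one (zero_le_one.trans hlog)
      push_cast
      linarith
    have hs : ((((t n + 1) * C.runStepBound n (t n + 1) : ℕ)) : ℝ) ≤
        (2 * t n) * (K * (t n * Nat.clog 2 (t n))) := by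
      exact_mod_cast Nat.mul_le_mul (by omega) (hK n (t n) hn ht2)
    rw [Real.norm_of_nonneg (by positivity), Real.norm_of_nonneg (by positivity)]
    refine hs.trans ?_
    calc (2 * (t n : ℝ)) * (K * (t n * Nat.clog 2 (t n)))
        ≤ (2 * (t n : ℝ)) * (K * (t n * (2 * Real.logb 2 (t n)))) := by gcongr
      _ = 4 * K * ((t n : ℝ) ^ 2 * Real.logb 2 (t n)) := by ring
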